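/- Let $R=[r^1,\dots,r^k]\in\mathbb{Q}^{2\times k}$ have nonzero columns and let $f\in\mathbb{Q}^2\setminus\mathbb{Z}^2$. Put $$P(R,f)^0=\{(x,s)\in\mathbb{R}^2\times\mathbb{R}^k_+ : f+Rs=x\},\qquad P(R,f)=\{(x,s)\in P(R,f)^0 : x\in\mathbb{Z}^2\},$$ and assume $P(R,f)\neq\emptyset$. Let $\sum_{i=1}^k\alpha_i s_i\ge 1$, with $\alpha_i\ge 0$ for all $i$, be a valid inequality for $\mathrm{conv}(P(R,f))$, and let $$L_\alpha=\mathrm{conv}\Big(\{f\}\cup\big\{f+\tfrac{r^i}{\alpha_i} : \alpha_i>0\big\}\Big)+\mathrm{cone}\{r^i : \alpha_i=0\}$$ be its induced lattice-free set. Suppose that $L_\alpha$ is a triangle of type $T^3$, that is, a triangle with no integer point in its interior, with non-integral vertices, and with exactly three integer points on its boundary, one in the relative interior of each side. Then the inequality $\sum_{i=1}^k\alpha_i s_i\ge 1$ has finite split rank with respect to $P(R,f)^0$. Here, for $S\subseteq\mathbb{R}^2\times\mathbb{R}^k$, the split closure of $S$ is $$\bigcap_{\pi\in\mathbb{Z}^2,\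 \pi_0\in\mathbb{Z}}\mathrm{conv}\big((S\cap\{(x,s):\pi^Tx\le\pi_0\})\cup(S\cap\{(x,s):\pi^Tx\ge\pi_0+1\})\big),$$ the $0$-th split closure of $P(R,f)^0$ is $P(R,f)^0$ itself and the $(n+1)$-st is the split closure of the $n$-th; the split rank of an inequality is the least $n\ge 0$ such that it is valid for the $n$-th split closure, and is infinite if there is no such $n$. -/

import Mathlib

namespace SplitRank

/-- The integer points of `ℝ^p`. -/
def latticePoints (p : ℕ) : Set (Fin p → ℝ) :=
  Set.range fun z : Fin p → ℤ => fun j => (z j : ℝ)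

/-- The part `(S ∩ {πᵀx ≤ π₀}) ∪ (S ∩ {πᵀx ≥ π₀ + 1})` of a set `S ⊆ ℝ^p × ℝ^q` satisfying the
split disjunction given by `π ∈ ℤ^p` and `π₀ ∈ ℤ`, followed by taking the convex hull. -/
def splitHull {p q : ℕ} (S : Set ((Fin p → ℝ) × (Fin q → ℝ))) (π : Fin p → ℤ) (π₀ : ℤ) :
    Set ((Fin p → ℝ) × (Fin q → ℝ)) :=
  convexHull ℝ
    ((S ∩ {z | ∑ j, (π j : ℝ) * z.1 j ≤ (π₀ : ℝ)}) ∪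
      (S ∩ {z | (π₀ : ℝ) + 1 ≤ ∑ j, (π j : ℝ) * z.1 j}))

/-- One round of the split closure: the intersection over all split disjunctions. -/
def splitClosure {p q : ℕ} (S : Set ((Fin p → ℝ) × (Fin q → ℝ))) :
    Set ((Fin p → ℝ) × (Fin q → ℝ)) :=
  ⋂ (π : Fin p → ℤ) (π₀ : ℤ), splitHull S π π₀

/-- The `n`-th split closure; the `0`-th one is the linear relaxation `S` itself. -/
def iterSplitClosure {p q : ℕ} (S : Set ((Fin p → ℝ) × (Fin q → ℝ))) :
    ℕ → Set ((Fin p → ℝ) × (Fin q → ℝ))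
  | 0 => S
  | n + 1 => splitClosure (iterSplitClosure S n)

/-- The inequality `aᵀx + bᵀy ≤ c` holds on all of `S`. -/
def IsValidIneq {p q : ℕ} (a : Fin p → ℝ) (b : Fin q → ℝ) (c : ℝ)
    (S : Set ((Fin p → ℝ) × (Fin q → ℝ))) : Prop :=
  ∀ z ∈ S, ∑ j, a j * z.1 j + ∑ i, b i * z.2 i ≤ c

/-- The split rank of `aᵀx + bᵀy ≤ c` with respect to the linear relaxation `S`: the least `n`
such that the inequality is valid for the `n`-th split closure, and `⊤` if there is none. -/
noncomputable def splitRank {p q : ℕ} (S : Set ((Fin p → ℝ) × (Fin q → ℝ)))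
    (a : Fin p → ℝ) (b : Fin q → ℝ) (c : ℝ) : ℕ∞ :=
  sInf {m : ℕ∞ | ∃ n : ℕ, m = (n : ℕ∞) ∧ IsValidIneq a b c (iterSplitClosure S n)}

/-- The `i`-th column of `R`, as a vector of `ℝ²`. -/
def col {k : ℕ} (R : Matrix (Fin 2) (Fin k) ℚ) (i : Fin k) : Fin 2 → ℝ :=
  fun j => (R j i : ℝ)

/-- A rational point of the plane, as a vector of `ℝ²`. -/
def toReal (f : Fin 2 → ℚ) : Fin 2 → ℝ :=
  fun j => (f j : ℝ)

/-- The linear relaxation `P(R,f)⁰ = {(x,s) ∈ ℝ² × ℝ^k | f + R s = x, s ≥ 0}`. -/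
def relaxation {k : ℕ} (R : Matrix (Fin 2) (Fin k) ℚ) (f : Fin 2 → ℚ) :
    Set ((Fin 2 → ℝ) × (Fin k → ℝ)) :=
  {z | toReal f + ∑ i, z.2 i • col R i = z.1 ∧ ∀ i, 0 ≤ z.2 i}

/-- The mixed integer set `P(R,f) = {(x,s) ∈ ℤ² × ℝ^k | f + R s = x, s ≥ 0}`. -/
def mixedIntegerSet {k : ℕ} (R : Matrix (Fin 2) (Fin k) ℚ) (f : Fin 2 → ℚ) :
    Set ((Fin 2 → ℝ) × (Fin k → ℝ)) :=
  {z ∈ relaxation R f | z.1 ∈ latticePoints 2}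

open scoped Pointwise in
/-- The set
`L_α = conv ({f} ∪ {f + rⁱ/αᵢ | αᵢ > 0}) + cone {rⁱ | αᵢ = 0}` induced by `∑ αᵢ sᵢ ≥ 1`. -/
def inducedSet {k : ℕ} (R : Matrix (Fin 2) (Fin k) ℚ) (f : Fin 2 → ℚ) (α : Fin k → ℝ) :
    Set (Fin 2 → ℝ) :=
  convexHull ℝ (insert (toReal f) {y | ∃ i, 0 < α i ∧ y = toReal f + (α i)⁻¹ • col R i}) +
    {y | ∃ c : Fin k → ℝ, (∀ i, 0 ≤ c i) ∧ (∀ i, α i ≠ 0 → c i = 0) ∧ y = ∑ i, c i • col R i}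

/-- No integer point lies in the interior. -/
def IsLatticeFree (T : Set (Fin 2 → ℝ)) : Prop :=
  interior T ∩ latticePoints 2 = ∅

/-- `T` is a triangle of type `T³`: a (nondegenerate) lattice-free triangle with non-integral
vertices and exactly three integer points on its boundary, one in the relative interior of each
side. -/
def IsTypeT3 (T : Set (Fin 2 → ℝ)) : Prop :=
  ∃ w : Fin 3 → (Fin 2 → ℝ),
    AffineIndependent ℝ w ∧
    T = convexHull ℝ (Set.range w) ∧
    IsLatticeFree T ∧
    (∀ i, w i ∉ latticePoints 2) ∧
    (frontier T ∩ latticePoints 2).ncard = 3 ∧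
    ∀ i j, i ≠ j → ∃! y, y ∈ openSegment ℝ (w i) (w j) ∧ y ∈ latticePoints 2

end SplitRank

/-
Write `φ = ∑ αᵢ sᵢ` and let `g₀, g₁, g₂` be the affine forms that vanish on the sides of the
triangle and equal `1` at `f`. On the relaxation `φ ≥ 1 - gᵢ(x)`, so `φ < 1` can only happen when
`x` is in the interior of the triangle.

On a compact set of `x` without integer points, splits on single coordinates close the gap up to
any `ε`: a point where `φ` is nearly minimal is a convex combination of points of the previous
closure where it is nearly minimal too, and one of them has a larger value of `∑ xⱼ²`. That sum is
bounded, so a fixed number of rounds shrinks the gap by a constant factor. This applies to the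
triangle cut off near its integer points, and since the `gᵢ` are rational, one more split on an
integral multiple of `gᵢ` improves the slope: `φ ≥ 1 - δ gᵢ(x)` where `gᵢ(x) ≥ 0`, for any
`δ > 0`.

The three integer points of the boundary form a unimodular triangle, so its barycentric
coordinates are integral forms and may be split on. Each `gᵢ` is positive at the two points not on
its side, and a small `δ` makes the bounds above strong enough that after one more round `φ ≥ 1`
on the three lines where a coordinate vanishes. The convex set `φ < 1` therefore stays in one sign
region of the coordinates, and a last split on a coordinate with value in `(0, 1)` would produce
points with conflicting signs, so the set is empty.
-/

namespace SplitRank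

open AffineMap Set Topology

section SplitClosures

variable {p q : ℕ} {E : Type*} [AddCommGroup E] [Module ℝ E]

lemma exists_lineMap_of_mem_segment (g : E →ᵃ[ℝ] ℝ) {u v z : E} (hu : g u ≤ 0) (hv : 1 ≤ g v)
    (hz : z ∈ segment ℝ u v) :
    ∃ x ∈ segment ℝ u v, ∃ y ∈ segment ℝ u v,
      g x = 0 ∧ g y = 1 ∧ z = lineMap x y (g z) := by
  rw [segment_eq_image_lineMap] at hz ⊢
  obtain ⟨r, -, rfl⟩ := hz
  have hpos : 0 < g v - g u := by linarith
  refine ⟨_, ⟨-g u / (g v - g u), ⟨by bound, (div_le_one hpos).2 (by linarith)⟩, rfl⟩,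
    _, ⟨(1 - g u) / (g v - g u), ⟨by bound, (div_le_one hpos).2 (by linarith)⟩, rfl⟩, ?_, ?_, ?_⟩
  · rw [apply_lineMap, lineMap_apply_ring]; field_simp; ring
  · rw [apply_lineMap, lineMap_apply_ring]; field_simp; ring
  · rw [← apply_lineMap (lineMap u v : ℝ →ᵃ[ℝ] E), apply_lineMap g]
    congr 1
    simp only [lineMap_apply_ring]; field_simp; ring

lemma exists_lineMap_of_mem_convexHull_union {S : Set E} (hS : Convex ℝ S) (g : E →ᵃ[ℝ] ℝ)
    {z : E} (hz : z ∈ convexHull ℝ ((S ∩ {x | g x ≤ 0}) ∪ (S ∩ {x | 1 ≤ g x})))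
    (h0 : 0 < g z) (h1 : g z < 1) :
    ∃ u ∈ S, ∃ v ∈ S, g u = 0 ∧ g v = 1 ∧ z = lineMap u v (g z) := by
  have hA : Convex ℝ (S ∩ {x | g x ≤ 0}) := hS.inter ((convex_Iic 0).affine_preimage g)
  have hB : Convex ℝ (S ∩ {x | 1 ≤ g x}) := hS.inter ((convex_Ici 1).affine_preimage g)
  obtain hempty | hAne := (S ∩ {x | g x ≤ 0}).eq_empty_or_nonempty
  · rw [hempty, empty_union, hB.convexHull_eq] at hz
    exact absurd hz.2 h1.not_ge
  obtain hempty | hBne := (S ∩ {x | 1 ≤ g x}).eq_empty_or_nonempty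
  · rw [hempty, union_empty, hA.convexHull_eq] at hz
    exact absurd hz.2 h0.not_ge
  rw [convexHull_union hAne hBne, hA.convexHull_eq, hB.convexHull_eq, mem_convexJoin] at hz
  obtain ⟨u, ⟨huS, hu⟩, v, ⟨hvS, hv⟩, hz⟩ := hz
  obtain ⟨x, hx, y, hy, h⟩ := exists_lineMap_of_mem_segment g hu hv hz
  exact ⟨x, hS.segment_subset huS hvS hx, y, hS.segment_subset huS hvS hy, h⟩

lemma splitHull_subset {S : Set ((Fin p → ℝ) × (Fin q → ℝ))} (hS : Convex ℝ S)
    (π : Fin p → ℤ) (π₀ : ℤ) : splitHull S π π₀ ⊆ S :=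
  convexHull_min (union_subset inter_subset_left inter_subset_left) hS

lemma splitClosure_subset {S : Set ((Fin p → ℝ) × (Fin q → ℝ))} (hS : Convex ℝ S) :
    splitClosure S ⊆ S :=
  (iInter₂_subset 0 0).trans (splitHull_subset hS 0 0)

lemma convex_iterSplitClosure {S : Set ((Fin p → ℝ) × (Fin q → ℝ))} (hS : Convex ℝ S) :
    ∀ n, Convex ℝ (iterSplitClosure S n)
  | 0 => hS
  | _ + 1 => convex_iInter₂ fun _ _ => convex_convexHull ℝ _

lemma iterSplitClosure_antitone {S : Set ((Fin p → ℝ) × (Fin q → ℝ))} (hS : Convex ℝ S) :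
    Antitone (iterSplitClosure S) :=
  antitone_nat_of_succ_le fun n => splitClosure_subset (convex_iterSplitClosure hS n)

/-- Affine forms taking integer values at the integer points; their strips `0 ≤ g ≤ 1` are exactly
the split disjunctions. -/
def IsIntegralForm (g : (Fin p → ℝ) →ᵃ[ℝ] ℝ) : Prop :=
  ∀ z ∈ latticePoints p, ∃ n : ℤ, g z = n

/-- The integer lattice `ℤ^p ⊆ ℝ^p`, as a subgroup. -/
def latticeSubgroup (p : ℕ) : AddSubgroup (Fin p → ℝ) where
  carrier := latticePoints p
  zero_mem' := ⟨0, by ext; simp⟩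
  add_mem' := by
    rintro _ _ ⟨a, rfl⟩ ⟨b, rfl⟩
    exact ⟨a + b, by ext; simp⟩
  neg_mem' := by
    rintro _ ⟨a, rfl⟩
    exact ⟨-a, by ext; simp⟩

lemma single_mem_latticePoints (j : Fin p) : Pi.single j 1 ∈ latticePoints p :=
  ⟨Pi.single j 1, by ext i; simp [Pi.single_apply]⟩

lemma apply_eq_sum_single (g : (Fin p → ℝ) →ᵃ[ℝ] ℝ) (x : Fin p → ℝ) :
    g x = ∑ j, (g (Pi.single j 1) - g 0) * x j + g 0 := by
  have hlin (y : Fin p → ℝ) : g.linear y = g y - g 0 := by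
    rw [g.decomp']; simp
  rw [← sub_eq_iff_eq_add, ← hlin, LinearMap.pi_apply_eq_sum_univ]
  refine Finset.sum_congr rfl fun j _ => ?_
  rw [smul_eq_mul, mul_comm, ← hlin]
  congr 2
  ext i
  simp [Pi.single_apply, eq_comm]

lemma IsIntegralForm.exists_eq_sum {g : (Fin p → ℝ) →ᵃ[ℝ] ℝ} (hg : IsIntegralForm g) :
    ∃ (π : Fin p → ℤ) (π₀ : ℤ), ∀ x, g x = ∑ j, (π j : ℝ) * x j - π₀ := by
  obtain ⟨n₀, hn₀⟩ := hg 0 (zero_mem (latticeSubgroup p))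
  choose n hn using fun j => hg _ (single_mem_latticePoints j)
  refine ⟨fun j => n j - n₀, -n₀, fun x => ?_⟩
  rw [apply_eq_sum_single]
  simp [hn, hn₀]

lemma exists_lineMap_of_mem_iterSplitClosure_succ {S : Set ((Fin p → ℝ) × (Fin q → ℝ))}
    (hS : Convex ℝ S) {n : ℕ} {z : (Fin p → ℝ) × (Fin q → ℝ)}
    (hz : z ∈ iterSplitClosure S (n + 1)) {g : (Fin p → ℝ) →ᵃ[ℝ] ℝ} (hg : IsIntegralForm g)
    {t : ℝ} (ht : g z.1 = t) (ht₀ : 0 < t) (ht₁ : t < 1) :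
    ∃ u ∈ iterSplitClosure S n, ∃ v ∈ iterSplitClosure S n,
      g u.1 = 0 ∧ g v.1 = 1 ∧ z = lineMap u v t := by
  subst ht
  obtain ⟨π, π₀, hπ⟩ := hg.exists_eq_sum
  refine exists_lineMap_of_mem_convexHull_union (convex_iterSplitClosure hS n)
    (g.comp AffineMap.fst) ?_ ht₀ ht₁
  have hz' := mem_iInter₂.1 hz π π₀
  simpa only [splitHull, coe_comp, Function.comp_apply, coe_fst, hπ, sub_nonpos, le_sub_iff_add_le,
    add_comm] using hz'

end SplitClosures

section Convergence

variable {p q : ℕ}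

lemma isClosed_latticePoints : IsClosed (latticePoints p) := by
  have hpi : latticePoints p = univ.pi fun _ => range ((↑) : ℤ → ℝ) := by
    ext x
    simp only [latticePoints, mem_range, mem_univ_pi, funext_iff, Classical.skolem]
  exact hpi ▸ isClosed_set_pi fun _ _ => Int.isClosedEmbedding_coe_real.isClosed_range

lemma exists_forall_fract_mem_Icc {K : Set (Fin p → ℝ)} (hK : IsCompact K)
    (hKL : Disjoint K (latticePoints p)) :
    ∃ w : ℝ, 0 < w ∧ w ≤ 1 ∧ ∀ x ∈ K, ∃ j, Int.fract (x j) ∈ Icc w (1 - w) := by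
  obtain ⟨δ, hδ, hsub⟩ := hK.exists_thickening_subset_open isClosed_latticePoints.isOpen_compl
    hKL.subset_compl_right
  refine ⟨min δ 1, lt_min hδ one_pos, min_le_right _ _, fun x hx => ?_⟩
  by_contra! hfar
  refine hsub (Metric.mem_thickening_iff.2 ⟨x, hx, ?_⟩) ⟨fun j => round (x j), rfl⟩
  rw [dist_comm, dist_pi_lt_iff hδ]
  intro j
  rw [Real.dist_eq, abs_sub_round_eq_min, ← not_le, le_min_iff]
  rintro ⟨h₀, h₁⟩
  exact hfar j ⟨min_le_of_left_le h₀, by linarith [min_le_left δ 1]⟩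

lemma sum_sq_lineMap {ι : Type*} [Fintype ι] (u v : ι → ℝ) (t : ℝ) :
    ∑ j, lineMap u v t j ^ 2 + t * (1 - t) * ∑ j, (v j - u j) ^ 2 =
      (1 - t) * ∑ j, u j ^ 2 + t * ∑ j, v j ^ 2 := by
  simp only [Finset.mul_sum, ← Finset.sum_add_distrib]
  refine Finset.sum_congr rfl fun j _ => ?_
  rw [pi_lineMap_apply, lineMap_apply_ring]
  ring

lemma sum_sq_lineMap_le {ι : Type*} [Fintype ι] {u v : ι → ℝ} {j : ι} (huv : v j - u j = 1)
    {t w B : ℝ} (hw : 0 ≤ w) (ht : t ∈ Icc w (1 - w)) (hu : ∑ i, u i ^ 2 ≤ B)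
    (hv : ∑ i, v i ^ 2 ≤ B) :
    ∑ i, lineMap u v t i ^ 2 ≤ B - w ^ 2 := by
  have hgap : 1 ≤ ∑ i, (v i - u i) ^ 2 :=
    calc 1 = (v j - u j) ^ 2 := by rw [huv, one_pow]
      _ ≤ _ := Finset.single_le_sum (fun i _ => sq_nonneg (v i - u i)) (Finset.mem_univ j)
  have htw : w * w ≤ t * (1 - t) :=
    mul_le_mul ht.1 (le_sub_comm.1 ht.2) hw (hw.trans ht.1)
  nlinarith [sum_sq_lineMap u v t, ht.1, ht.2]

lemma isIntegralForm_coord_sub (j : Fin p) (n : ℤ) :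
    IsIntegralForm ((LinearMap.proj j).toAffineMap - const ℝ (Fin p → ℝ) (n : ℝ)) := by
  rintro _ ⟨z, rfl⟩
  exact ⟨z j - n, by simp⟩

variable {S : Set ((Fin p → ℝ) × (Fin q → ℝ))} {φ : ((Fin p → ℝ) × (Fin q → ℝ)) →ᵃ[ℝ] ℝ}
  {K : Set (Fin p → ℝ)} {c m w Ψ : ℝ}

/- Near-minimal points of one closure are combinations of near-minimal points of the previous one,
and by strict convexity the sum of squares then drops by at least `w ^ 2`. -/
lemma sum_sq_le_of_lt (hS : Convex ℝ S) (hw : 0 < w) (hw₁ : w ≤ 1)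
    (hfract : ∀ x ∈ K, ∃ j, Int.fract (x j) ∈ Icc w (1 - w)) (hΨ : ∀ x ∈ K, ∑ j, x j ^ 2 ≤ Ψ)
    (hm : ∀ z ∈ S, m ≤ φ z) (hc : ∀ z ∈ S, z.1 ∉ K → c ≤ φ z) (n : ℕ)
    {z : (Fin p → ℝ) × (Fin q → ℝ)} (hz : z ∈ iterSplitClosure S n)
    (hφz : φ z < m + w ^ n * (c - m)) :
    z.1 ∈ K ∧ ∑ j, z.1 j ^ 2 ≤ Ψ - n * w ^ 2 := by
  induction n generalizing z with
  | zero =>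
    have hzK : z.1 ∈ K := by
      by_contra hzK
      linarith [hc z hz hzK]
    simpa using ⟨hzK, hΨ _ hzK⟩
  | succ n ih =>
    have hmono {i : ℕ} {y} (hy : y ∈ iterSplitClosure S i) : m ≤ φ y :=
      hm y (iterSplitClosure_antitone hS i.zero_le hy)
    have hcm : 0 < w ^ n * (c - m) := by
      rw [pow_succ', mul_assoc] at hφz
      exact pos_of_mul_pos_right (by linarith [hmono hz]) hw.le
    have hzK : z.1 ∈ K := by
      refine (ih (iterSplitClosure_antitone hS n.le_succ hz) (hφz.trans_le ?_)).1
      rw [pow_succ', mul_assoc]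
      linarith [mul_le_of_le_one_left hcm.le hw₁]
    obtain ⟨j, ht⟩ := hfract _ hzK
    generalize hjt : Int.fract (z.1 j) = t at ht
    have ht₀ : 0 < t := hw.trans_le ht.1
    have ht₁ : w ≤ 1 - t := le_sub_comm.1 ht.2
    obtain ⟨u, hu, v, hv, hu₀, hv₁, rfl⟩ := exists_lineMap_of_mem_iterSplitClosure_succ hS hz
      (isIntegralForm_coord_sub j ⌊z.1 j⌋) hjt ht₀ (by linarith)
    simp only [AffineMap.coe_sub, Pi.sub_apply, LinearMap.coe_toAffineMap, LinearMap.proj_apply,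
      const_apply] at hu₀ hv₁
    rw [apply_lineMap, lineMap_apply_ring, pow_succ', mul_assoc] at hφz
    have hΦu := (ih hu (by nlinarith [hmono hv, ht.1])).2
    have hΦv := (ih hv (by nlinarith [hmono hu, ht.1])).2
    refine ⟨hzK, ?_⟩
    rw [fst_lineMap, Nat.cast_succ, add_one_mul, ← sub_sub]
    exact sum_sq_lineMap_le (by linarith) hw.le ht hΦu hΦv

lemma iterSplitClosure_add (S : Set ((Fin p → ℝ) × (Fin q → ℝ))) (n : ℕ) :
    ∀ j, iterSplitClosure S (n + j) = iterSplitClosure (iterSplitClosure S n) j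
  | 0 => rfl
  | j + 1 => congrArg splitClosure (iterSplitClosure_add S n j)

lemma exists_contraction (hK : IsCompact K) (hKL : Disjoint K (latticePoints p))
    (φ : ((Fin p → ℝ) × (Fin q → ℝ)) →ᵃ[ℝ] ℝ) (c : ℝ) :
    ∃ n, ∃ κ ∈ Ioc (0 : ℝ) 1, ∀ S, Convex ℝ S → (∀ z ∈ S, z.1 ∉ K → c ≤ φ z) →
      ∀ m, (∀ z ∈ S, m ≤ φ z) → ∀ z ∈ iterSplitClosure S n, m + κ * (c - m) ≤ φ z := by
  obtain ⟨w, hw, hw₁, hfract⟩ := exists_forall_fract_mem_Icc hK hKL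
  obtain ⟨Ψ, hΨ⟩ := hK.bddAbove_image
    (f := fun x => ∑ j, x j ^ 2) (by fun_prop)
  obtain ⟨n, hn⟩ := exists_nat_gt (Ψ / w ^ 2)
  refine ⟨n, w ^ n, ⟨by positivity, pow_le_one₀ hw.le hw₁⟩, fun S hS hc m hm z hz => ?_⟩
  by_contra! hφz
  have hle := (sum_sq_le_of_lt hS hw hw₁ hfract (fun x hx => hΨ ⟨x, hx, rfl⟩) hm hc n hz hφz).2
  rw [div_lt_iff₀ (by positivity)] at hn
  linarith [Finset.sum_nonneg fun j (_ : j ∈ Finset.univ) => sq_nonneg (z.1 j)]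

theorem exists_iterSplitClosure_le (hS : Convex ℝ S) (hK : IsCompact K)
    (hKL : Disjoint K (latticePoints p)) (hm : ∀ z ∈ S, m ≤ φ z)
    (hc : ∀ z ∈ S, z.1 ∉ K → c ≤ φ z) {c' : ℝ} (hc' : c' < c) :
    ∃ n, ∀ z ∈ iterSplitClosure S n, c' ≤ φ z := by
  obtain ⟨J, κ, ⟨hκ₀, hκ₁⟩, hκ⟩ := exists_contraction hK hKL φ c
  have hiter (k : ℕ) : ∀ z ∈ iterSplitClosure S (k * J), c - (1 - κ) ^ k * (c - m) ≤ φ z := by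
    induction k with
    | zero => simpa [iterSplitClosure] using hm
    | succ k ih =>
      intro z hz
      rw [add_one_mul, iterSplitClosure_add] at hz
      have hstep := hκ _ (convex_iterSplitClosure hS _)
        (fun z hz => hc z (iterSplitClosure_antitone hS (k * J).zero_le hz)) _ ih z hz
      linear_combination hstep
  have hlim : Filter.Tendsto (fun k => (1 - κ) ^ k * (c - m)) Filter.atTop (𝓝 0) := by
    simpa using (tendsto_pow_atTop_nhds_zero_of_lt_one (by linarith : 0 ≤ 1 - κ)
      (by linarith)).mul_const (c - m)
  obtain ⟨k, hk⟩ := (hlim.eventually_lt_const (sub_pos.2 hc')).exists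
  exact ⟨k * J, fun z hz => by linarith [hiter k z hz]⟩

lemma sub_mul_le_of_mem_iterSplitClosure_succ (hS : Convex ℝ S) {n : ℕ}
    {g : (Fin p → ℝ) →ᵃ[ℝ] ℝ} (hg : IsIntegralForm g) {δ : ℝ} (hδ : 0 ≤ δ)
    (hside : ∀ z ∈ iterSplitClosure S n, g z.1 ≤ 0 → c ≤ φ z)
    (hδφ : ∀ z ∈ iterSplitClosure S n, c - δ ≤ φ z)
    {z : (Fin p → ℝ) × (Fin q → ℝ)} (hz : z ∈ iterSplitClosure S (n + 1)) (hgz : 0 ≤ g z.1) :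
    c - δ * g z.1 ≤ φ z := by
  have hzn := iterSplitClosure_antitone hS n.le_succ hz
  obtain h₀ | h₀ := hgz.eq_or_lt
  · simpa [← h₀] using hside z hzn h₀.ge
  obtain h₁ | h₁ := le_or_gt 1 (g z.1)
  · linarith [hδφ z hzn, le_mul_of_one_le_right hδ h₁]
  generalize ht : g z.1 = t at h₀ h₁
  obtain ⟨u, hu, v, hv, hu₀, -, rfl⟩ :=
    exists_lineMap_of_mem_iterSplitClosure_succ hS hz hg ht h₀ h₁
  rw [apply_lineMap, lineMap_apply_ring]
  linear_combination (1 - t) * hside u hu hu₀.le + t * hδφ v hv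

end Convergence

section Unimodular

lemma forall_fin_three {P : Fin 3 → Prop} (i : Fin 3) :
    (∀ j, P j) ↔ P i ∧ P (i + 1) ∧ P (i + 2) := by
  have hcases (j : Fin 3) : j = i ∨ j = i + 1 ∨ j = i + 2 := by decide +revert
  refine ⟨fun h => ⟨h _, h _, h _⟩, fun h j => ?_⟩
  rcases hcases j with hj | hj | hj <;> simp only [hj, h]

lemma add_one_ne_self (i : Fin 3) : i + 1 ≠ i := by
  decide +revert

lemma add_two_ne_self (i : Fin 3) : i + 2 ≠ i := by
  decide +revert

lemma add_two_ne_add_one (i : Fin 3) : i + 2 ≠ i + 1 := by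
  decide +revert

lemma add_two_add_one (i : Fin 3) : i + 2 + 1 = i := by
  decide +revert

lemma add_one_add_one (i : Fin 3) : i + 1 + 1 = i + 2 := by
  decide +revert

lemma add_one_add_two (i : Fin 3) : i + 1 + 2 = i := by
  decide +revert

lemma add_two_add_two (i : Fin 3) : i + 2 + 2 = i + 1 := by
  decide +revert

lemma sum_fin_three {M : Type*} [AddCommMonoid M] (F : Fin 3 → M) (i : Fin 3) :
    ∑ j, F j = F i + F (i + 1) + F (i + 2) := by
  fin_cases i <;> simp [Fin.sum_univ_three] <;> abel

variable {V : Type*} [AddCommGroup V] [Module ℝ V]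

lemma apply_eq_sum_coord {ι : Type*} [Fintype ι] (c : AffineBasis ι ℝ V) (g : V →ᵃ[ℝ] ℝ) (x : V) :
    g x = ∑ i, c.coord i x * g (c i) := by
  have h := Finset.univ.map_affineCombination c (fun i => c.coord i x)
    (c.sum_coord_apply_eq_one x) g
  rw [c.affineCombination_coord_eq_self,
    Finset.affineCombination_eq_linear_combination _ _ _ (c.sum_coord_apply_eq_one x)] at h
  exact h

variable (c : AffineBasis (Fin 3) ℝ V) {L : AddSubgroup V}

lemma sum_coord_fin_three (x : V) (i : Fin 3) :
    c.coord i x + c.coord (i + 1) x + c.coord (i + 2) x = 1 := by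
  rw [← sum_fin_three fun j => c.coord j x, c.sum_coord_apply_eq_one]

lemma coord_eq_zero_or_one {x : V} (hx : x ∈ range c) (i : Fin 3) :
    c.coord i x = 0 ∨ c.coord i x = 1 := by
  obtain ⟨j, rfl⟩ := hx
  rw [c.coord_apply]
  exact (ite_eq_or_eq _ _ _).symm

lemma exists_mem_coord_eq_fract (hc : ∀ i, c i ∈ L) {x : V} (hx : x ∈ L) (i : Fin 3) :
    ∃ y ∈ L, c.coord i y = Int.fract (c.coord i x) ∧
      c.coord (i + 1) y = Int.fract (c.coord (i + 1) x) := by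
  refine ⟨(⌊c.coord i x⌋ • (c (i + 2) -ᵥ c i) +
      ⌊c.coord (i + 1) x⌋ • (c (i + 2) -ᵥ c (i + 1))) +ᵥ x,
    L.add_mem (L.add_mem (L.zsmul_mem (L.sub_mem (hc _) (hc _)) _)
      (L.zsmul_mem (L.sub_mem (hc _) (hc _)) _)) hx, ?_, ?_⟩ <;>
  rw [AffineMap.map_vadd, map_add, map_zsmul, map_zsmul, linearMap_vsub, linearMap_vsub] <;>
  simp [(add_one_ne_self _).symm, (add_two_ne_self _).symm,
    (add_two_ne_add_one _).symm, neg_add_eq_sub]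

lemma exists_mem_coord_eq_one_sub (hc : ∀ i, c i ∈ L) {x : V} (hx : x ∈ L) (i : Fin 3) :
    ∃ y ∈ L, c.coord i y = 1 - c.coord i x ∧ c.coord (i + 1) y = 1 - c.coord (i + 1) x := by
  refine ⟨(c i -ᵥ x) +ᵥ c (i + 1), L.add_mem (L.sub_mem (hc _) hx) (hc _), ?_, ?_⟩ <;>
  rw [AffineMap.map_vadd, linearMap_vsub] <;>
  simp [(add_one_ne_self _).symm, neg_add_eq_sub]

/- Translating by the edges and, if needed, reflecting in the midpoint of an edge moves every
lattice point into the triangle. -/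
lemma exists_coord_eq_intCast (hc : ∀ i, c i ∈ L)
    (hL : ∀ x ∈ L, (∀ i, 0 ≤ c.coord i x) → x ∈ range c) {x : V} (hx : x ∈ L) (i : Fin 3) :
    ∃ n : ℤ, c.coord i x = n := by
  suffices Int.fract (c.coord i x) = 0 by
    obtain ⟨n, hn⟩ := Int.fract_eq_zero_iff.1 this
    exact ⟨n, hn.symm⟩
  obtain ⟨y, hy, hyi, hyi'⟩ := exists_mem_coord_eq_fract c hc hx i
  have hs₀ := Int.fract_nonneg (c.coord i x)
  have hs₁ := Int.fract_lt_one (c.coord i x)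
  have ht₀ := Int.fract_nonneg (c.coord (i + 1) x)
  have ht₁ := Int.fract_lt_one (c.coord (i + 1) x)
  have hmem {z : V} (hz : z ∈ L) (h₀ : 0 ≤ c.coord i z) (h₁ : 0 ≤ c.coord (i + 1) z)
      (h₂ : c.coord i z + c.coord (i + 1) z ≤ 1) : z ∈ range c :=
    hL z hz ((forall_fin_three i).2 ⟨h₀, h₁, by linarith [sum_coord_fin_three c z i]⟩)
  obtain hle | hlt := le_or_gt (Int.fract (c.coord i x) + Int.fract (c.coord (i + 1) x)) 1
  · have hyc : y ∈ range c := hmem hy (by linarith) (by linarith) (by linarith)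
    rw [← hyi] at hs₁ ⊢
    exact (coord_eq_zero_or_one c hyc i).resolve_right hs₁.ne
  · obtain ⟨z, hz, hzi, hzi'⟩ := exists_mem_coord_eq_one_sub c hc hy i
    have hzc : z ∈ range c := hmem hz (by linarith) (by linarith) (by linarith)
    obtain h | h := coord_eq_zero_or_one c hzc i <;> linarith

end Unimodular

section RealAnalysis

lemma eventually_forall_mul_le {ι : Type*} [Finite ι] (x : ι → ℝ) {y : ι → ℝ}
    (hy : ∀ i, 0 < y i) : ∀ᶠ δ in 𝓝[>] (0 : ℝ), ∀ i, δ * x i ≤ y i := by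
  refine Filter.eventually_all.2 fun i => ?_
  have hlim : Filter.Tendsto (fun δ : ℝ => δ * x i) (𝓝[>] 0) (𝓝 0) := by
    simpa using (Filter.tendsto_id.mono_left nhdsWithin_le_nhds : Filter.Tendsto (fun δ : ℝ => δ)
      (𝓝[>] 0) (𝓝 0)).mul_const (x i)
  exact hlim.eventually_le_const (hy i)

lemma one_le_of_slope_le {t a b P Q x y δ : ℝ} (ht : t ∈ Icc (0 : ℝ) 1)
    (hab : (1 - t) * a + t * b = 0) (hx : 1 - P * a ≤ x) (hy : 1 - Q * b ≤ y)
    (hx' : 0 ≤ a → 1 - δ * (P * a) ≤ x) (hy' : 0 ≤ b → 1 - δ * (Q * b) ≤ y)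
    (hPQ : δ * P ≤ Q) (hQP : δ * Q ≤ P) : 1 ≤ (1 - t) * x + t * y := by
  have ht₀ := ht.1
  have ht₁ : 0 ≤ 1 - t := sub_nonneg.2 ht.2
  obtain ha | ha := le_or_gt 0 a
  · linear_combination (1 - t) * hx' ha + t * hy + (1 - t) * a * hPQ + Q * hab
  · have hb : 0 ≤ b := by
      by_contra! hb
      exact (convex_Iio (0 : ℝ) ha hb ht₁ ht₀ (by ring)).ne hab
    linear_combination (1 - t) * hx + t * hy' hb + t * b * hQP + P * hab

lemma pos_of_forall_ne_zero {E : Type*} [AddCommGroup E] [Module ℝ E] {C : Set E}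
    (hC : Convex ℝ C) (g : E →ᵃ[ℝ] ℝ) (hg : ∀ x ∈ C, g x ≠ 0) {u v : E} (hu : u ∈ C) (hv : v ∈ C)
    (hgu : 0 < g u) : 0 < g v := by
  by_contra! hgv
  obtain ⟨x, hx, hgx⟩ := (hC.affine_image g).ordConnected.out
    (mem_image_of_mem g hv) (mem_image_of_mem g hu) ⟨hgv, hgu.le⟩
  exact hg x hx hgx

end RealAnalysis

/-- A triangle in the plane with rational sides, whose integer points are one point in the relative
interior of each side. It is described by its slack functions: the `i`-th side lies on the line
`slack i = 0` and contains `point i`. -/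
structure T3Triangle where
  slack : Fin 3 → (Fin 2 → ℝ) →ᵃ[ℝ] ℝ
  point : AffineBasis (Fin 3) ℝ (Fin 2 → ℝ)
  point_mem : ∀ i, point i ∈ latticePoints 2
  slack_point_self : ∀ i, slack i (point i) = 0
  slack_point_pos : ∀ i j, i ≠ j → 0 < slack i (point j)
  mem_range_point : ∀ z ∈ latticePoints 2, (∀ i, 0 ≤ slack i z) → z ∈ range point
  exists_isIntegralForm_smul : ∀ i, ∃ N : ℕ, 0 < N ∧ IsIntegralForm ((N : ℝ) • slack i)
  isCompact : IsCompact {x | ∀ i, 0 ≤ slack i x}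

namespace T3Triangle

section Orientation

variable (T : T3Triangle)

lemma slack_point_nonneg (i j : Fin 3) : 0 ≤ T.slack i (T.point j) := by
  obtain rfl | hij := eq_or_ne i j
  · exact (T.slack_point_self i).ge
  · exact (T.slack_point_pos i j hij).le

lemma slack_eq (i : Fin 3) (x : Fin 2 → ℝ) :
    T.slack i x = T.slack i (T.point (i + 1)) * T.point.coord (i + 1) x +
      T.slack i (T.point (i + 2)) * T.point.coord (i + 2) x := by
  rw [apply_eq_sum_coord T.point, sum_fin_three _ i, T.slack_point_self, mul_zero, zero_add]
  ring

lemma isIntegralForm_coord (i : Fin 3) : IsIntegralForm (T.point.coord i) := fun _ hz =>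
  exists_coord_eq_intCast T.point (L := latticeSubgroup 2) T.point_mem
    (fun x hx hcoord => T.mem_range_point x hx fun j => by
      rw [apply_eq_sum_coord T.point]
      exact Finset.sum_nonneg fun l _ => mul_nonneg (hcoord l) (T.slack_point_nonneg j l)) hz i

lemma slack_point_lt_of_le {i : Fin 3}
    (hi : T.slack i (T.point (i + 1)) ≤ T.slack i (T.point (i + 2))) :
    T.slack (i + 2) (T.point i) < T.slack (i + 2) (T.point (i + 1)) := by
  set z := (T.point i -ᵥ T.point (i + 1)) +ᵥ T.point (i + 2) with hz
  have happly (g : (Fin 2 → ℝ) →ᵃ[ℝ] ℝ) :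
      g z = g (T.point i) - g (T.point (i + 1)) + g (T.point (i + 2)) := by
    rw [hz, AffineMap.map_vadd, linearMap_vsub, vsub_eq_sub, vadd_eq_add]
  have hzmem : z ∈ latticePoints 2 :=
    (latticeSubgroup 2).add_mem ((latticeSubgroup 2).sub_mem (T.point_mem _) (T.point_mem _))
      (T.point_mem _)
  have hzrange : z ∉ range T.point := fun h => by
    have hcoord : T.point.coord (i + 1) z = -1 := by
      rw [happly]
      simp
    obtain h | h := coord_eq_zero_or_one T.point h (i + 1) <;> norm_num [hcoord] at h
  by_contra! hle
  refine hzrange (T.mem_range_point z hzmem ((forall_fin_three i).2 ?_))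
  simp only [happly, T.slack_point_self]
  refine ⟨by linarith, ?_, by linarith⟩
  linarith [T.slack_point_nonneg (i + 1) i, T.slack_point_nonneg (i + 1) (i + 2)]

/-- The triangle with its sides renumbered. -/
def reindex (e : Fin 3 ≃ Fin 3) : T3Triangle where
  slack i := T.slack (e i)
  point := T.point.reindex e.symm
  point_mem _ := T.point_mem _
  slack_point_self _ := T.slack_point_self _
  slack_point_pos _ _ hij := T.slack_point_pos _ _ (e.injective.ne hij)
  mem_range_point z hz hslack := by
    rw [AffineBasis.coe_reindex, Equiv.symm_symm, e.surjective.range_comp]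
    exact T.mem_range_point z hz (e.surjective.forall.2 hslack)
  exists_isIntegralForm_smul _ := T.exists_isIntegralForm_smul _
  isCompact := by
    have hset : {x | ∀ i, 0 ≤ T.slack (e i) x} = {x | ∀ i, 0 ≤ T.slack i x} :=
      Set.ext fun x => e.forall_congr_right (q := fun i => 0 ≤ T.slack i x)
    exact hset ▸ T.isCompact

/-- Each slack function is larger at the next point than at the one after it. -/
def IsCyclic : Prop :=
  ∀ i, T.slack i (T.point (i + 2)) < T.slack i (T.point (i + 1))

lemma isCyclic_or_isCyclic_reindex_neg :
    T.IsCyclic ∨ (T.reindex (Equiv.neg (Fin 3))).IsCyclic := by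
  refine or_iff_not_imp_left.2 fun hT => ?_
  obtain ⟨i, hi⟩ := not_forall.1 hT
  have hprev (j : Fin 3) (hj : T.slack j (T.point (j + 1)) ≤ T.slack j (T.point (j + 2))) :
      T.slack (j + 2) (T.point (j + 2 + 1)) < T.slack (j + 2) (T.point (j + 2 + 2)) := by
    rw [add_two_add_one, add_two_add_two]
    exact T.slack_point_lt_of_le hj
  have h₂ := hprev i (not_lt.1 hi)
  have h₁ := hprev _ h₂.le
  rw [add_two_add_two] at h₁
  have h₀ := hprev _ h₁.le
  rw [add_one_add_two] at h₀
  have hall : ∀ j, T.slack j (T.point (j + 1)) < T.slack j (T.point (j + 2)) :=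
    (forall_fin_three i).2 ⟨h₀, h₁, h₂⟩
  intro j
  change T.slack (-j) (T.point (-(j + 2))) < T.slack (-j) (T.point (-(j + 1)))
  rw [show -(j + 2) = -j + 1 by decide +revert, show -(j + 1) = -j + 2 by decide +revert]
  exact hall (-j)

end Orientation

section FiniteRank

variable {T : T3Triangle} {q : ℕ} {S : Set ((Fin 2 → ℝ) × (Fin q → ℝ))}
  {φ : ((Fin 2 → ℝ) × (Fin q → ℝ)) →ᵃ[ℝ] ℝ} {m : ℝ}

lemma exists_one_sub_le (hS : Convex ℝ S) (hφ : ∀ z ∈ S, ∀ i, 1 - T.slack i z.1 ≤ φ z)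
    (hm : ∀ z ∈ S, m ≤ φ z) {ε : ℝ} (hε : 0 < ε) :
    ∃ n, ∀ z ∈ iterSplitClosure S n, 1 - ε ≤ φ z := by
  have hK : IsCompact {x | ∀ i, ε / 2 ≤ T.slack i x} := by
    refine T.isCompact.of_isClosed_subset ?_ fun x hx i => (half_pos hε).le.trans (hx i)
    simp only [ofPred_forall]
    exact isClosed_iInter fun i =>
      isClosed_le continuous_const (T.slack i).continuous_of_finiteDimensional
  refine exists_iterSplitClosure_le hS hK (disjoint_left.2 fun x hx hxL => ?_) hm
    (c := 1 - ε / 2) (fun z hz hzK => ?_) (by linarith)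
  · obtain ⟨i, rfl⟩ := T.mem_range_point x hxL fun i => (half_pos hε).le.trans (hx i)
    linarith [hx i, T.slack_point_self i]
  · obtain ⟨i, hi⟩ := not_forall.1 hzK
    linarith [hφ z hz i]

lemma exists_one_sub_mul_slack_le (hS : Convex ℝ S)
    (hφ : ∀ z ∈ S, ∀ i, 1 - T.slack i z.1 ≤ φ z) (hm : ∀ z ∈ S, m ≤ φ z) {δ : ℝ} (hδ : 0 < δ) :
    ∃ n, ∀ z ∈ iterSplitClosure S n, ∀ i, 0 ≤ T.slack i z.1 → 1 - δ * T.slack i z.1 ≤ φ z := by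
  choose N hN hint using T.exists_isIntegralForm_smul
  obtain ⟨ε, hεN, hε⟩ := ((eventually_forall_mul_le (fun i => (N i : ℝ)) fun _ => hδ).and
    self_mem_nhdsWithin).exists
  obtain ⟨n, hn⟩ := exists_one_sub_le hS hφ hm hε
  refine ⟨n + 1, fun z hz i hi => ?_⟩
  have hNpos : (0 : ℝ) < N i := Nat.cast_pos.2 (hN i)
  calc 1 - δ * T.slack i z.1 ≤ 1 - ε * ((N i : ℝ) • T.slack i) z.1 := by
        have := mul_le_mul_of_nonneg_right (hεN i) hi
        rw [AffineMap.coe_smul, Pi.smul_apply, smul_eq_mul]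
        linarith
    _ ≤ φ z := by
        refine sub_mul_le_of_mem_iterSplitClosure_succ hS (hint i) hε.le (fun y hy hyi => ?_) hn hz
          (mul_nonneg hNpos.le hi)
        have hslack : T.slack i y.1 ≤ 0 := nonpos_of_mul_nonpos_right hyi hNpos
        linarith [hφ y (iterSplitClosure_antitone hS n.zero_le hy) i]

lemma slack_add_two_eq (T : T3Triangle) {i : Fin 3} {x : Fin 2 → ℝ} (hx : T.point.coord i x = 0) :
    T.slack (i + 2) x = T.slack (i + 2) (T.point (i + 1)) * T.point.coord (i + 1) x := by
  rw [slack_eq, add_two_add_one, add_two_add_two, hx, mul_zero, zero_add]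

lemma slack_eq_of_coord_eq_one (T : T3Triangle) {i : Fin 3} {x : Fin 2 → ℝ}
    (hx : T.point.coord i x = 1) :
    T.slack i x = (T.slack i (T.point (i + 1)) - T.slack i (T.point (i + 2))) *
      T.point.coord (i + 1) x := by
  rw [slack_eq]
  linear_combination T.slack i (T.point (i + 2)) * (sum_coord_fin_three T.point x i - hx)

lemma exists_slack_nonpos (T : T3Triangle) {i : Fin 3} {x : Fin 2 → ℝ}
    (hx : T.point.coord (i + 1) x = 0) (hxi : T.point.coord i x ∉ Ioo 0 1) :
    ∃ l, T.slack l x ≤ 0 := by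
  have hsum := sum_coord_fin_three T.point x i
  obtain h₀ | h₀ := le_or_gt (T.point.coord i x) 0
  · refine ⟨i + 2, ?_⟩
    rw [slack_eq, add_two_add_one, add_two_add_two, hx, mul_zero, add_zero]
    exact mul_nonpos_of_nonneg_of_nonpos (T.slack_point_nonneg _ _) h₀
  · refine ⟨i, ?_⟩
    have h₁ : 1 ≤ T.point.coord i x := not_lt.1 fun h₁ => hxi ⟨h₀, h₁⟩
    rw [slack_eq, hx, mul_zero, zero_add]
    exact mul_nonpos_of_nonneg_of_nonpos (T.slack_point_nonneg _ _) (by linarith)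

lemma IsCyclic.exists_one_le_of_coord_eq_zero (hT : T.IsCyclic) (hS : Convex ℝ S)
    (hφ : ∀ z ∈ S, ∀ i, 1 - T.slack i z.1 ≤ φ z) (hm : ∀ z ∈ S, m ≤ φ z) :
    ∃ n, ∀ z ∈ iterSplitClosure S n, ∀ i, T.point.coord i z.1 = 0 → 1 ≤ φ z := by
  have hP (i : Fin 3) : 0 < T.slack (i + 2) (T.point (i + 1)) :=
    T.slack_point_pos _ _ (add_two_ne_add_one i)
  have hQ (i : Fin 3) : 0 < T.slack i (T.point (i + 1)) - T.slack i (T.point (i + 2)) :=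
    sub_pos.2 (hT i)
  obtain ⟨δ, ⟨hPQ, hQP⟩, hδ⟩ := (((eventually_forall_mul_le _ hQ).and
    (eventually_forall_mul_le _ hP)).and self_mem_nhdsWithin).exists
  obtain ⟨n, hn⟩ := exists_one_sub_mul_slack_le hS hφ hm hδ
  refine ⟨n + 1, fun z hz j hj => ?_⟩
  obtain ⟨i, rfl⟩ : ∃ i : Fin 3, j = i + 1 := ⟨j + 2, (add_two_add_one j).symm⟩
  by_cases hzi : T.point.coord i z.1 ∈ Ioo 0 1
  swap
  · obtain ⟨l, hl⟩ := T.exists_slack_nonpos hj hzi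
    linarith [hφ z (iterSplitClosure_antitone hS (n + 1).zero_le hz) l]
  generalize ht : T.point.coord i z.1 = t at hzi
  obtain ⟨u, hu, v, hv, hu₀, hv₁, rfl⟩ :=
    exists_lineMap_of_mem_iterSplitClosure_succ hS hz (T.isIntegralForm_coord i) ht hzi.1 hzi.2
  have huS := iterSplitClosure_antitone hS n.zero_le hu
  have hvS := iterSplitClosure_antitone hS n.zero_le hv
  have hu' := slack_add_two_eq T hu₀
  have hv' := slack_eq_of_coord_eq_one T hv₁
  rw [fst_lineMap, apply_lineMap, lineMap_apply_ring] at hj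
  rw [apply_lineMap, lineMap_apply_ring]
  refine one_le_of_slope_le (Ioo_subset_Icc_self hzi) hj (hu' ▸ hφ u huS (i + 2)) (hv' ▸ hφ v hvS i)
    (fun ha => hu' ▸ hn u hu (i + 2) ?_) (fun hb => hv' ▸ hn v hv i ?_) (hPQ i) (hQP i)
  · exact hu' ▸ mul_nonneg (hP i).le ha
  · exact hv' ▸ mul_nonneg (hQ i).le hb

lemma IsCyclic.coord_add_one_lt_one (hT : T.IsCyclic) {x : Fin 2 → ℝ} (hx : ∀ i, 0 < T.slack i x)
    {i : Fin 3} (hi : 0 ≤ T.point.coord i x) : T.point.coord (i + 1) x < 1 := by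
  have hsum := sum_coord_fin_three T.point x i
  have hslack := hx (i + 1)
  rw [slack_eq, add_one_add_one, add_one_add_two] at hslack
  have hlt := hT (i + 1)
  rw [add_one_add_one, add_one_add_two] at hlt
  have hpos := T.slack_point_pos (i + 1) i (add_one_ne_self i)
  by_contra! h
  nlinarith [mul_nonneg (sub_nonneg.2 hlt.le) hi,
    mul_nonneg (T.slack_point_nonneg (i + 1) (i + 2)) (sub_nonneg.2 h)]

lemma IsCyclic.exists_coord_mem_Ioo (hT : T.IsCyclic) {x : Fin 2 → ℝ}
    (hx : ∀ i, 0 < T.slack i x) : ∃ i, T.point.coord i x ∈ Ioo 0 1 := by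
  by_contra! hout
  have hone {i : Fin 3} (hi : 0 < T.point.coord i x) : 1 ≤ T.point.coord i x :=
    not_lt.1 fun h => hout i ⟨hi, h⟩
  have hnext {i : Fin 3} (hi : 0 < T.point.coord i x) : T.point.coord (i + 1) x ≤ 0 := by
    by_contra! h
    exact (hT.coord_add_one_lt_one hx hi.le).not_ge (hone h)
  obtain ⟨i, hi⟩ : ∃ i, 0 < T.point.coord i x := by
    by_contra! h
    linarith [sum_coord_fin_three T.point x 0, h 0, h (0 + 1), h (0 + 2)]
  have hprev : T.point.coord (i + 2) x ≤ 0 := by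
    by_contra! h
    have := hnext h
    rw [add_two_add_one] at this
    exact this.not_gt hi
  refine (hx i).not_ge ?_
  rw [slack_eq]
  exact add_nonpos (mul_nonpos_of_nonneg_of_nonpos (T.slack_point_nonneg _ _) (hnext hi))
    (mul_nonpos_of_nonneg_of_nonpos (T.slack_point_nonneg _ _) hprev)

lemma IsCyclic.exists_lt_one_of_coord_mem_Ioo (hT : T.IsCyclic) (hS : Convex ℝ S)
    (hφ : ∀ z ∈ S, ∀ i, 1 - T.slack i z.1 ≤ φ z) {n : ℕ}
    (hline : ∀ z ∈ iterSplitClosure S n, ∀ i, T.point.coord i z.1 = 0 → 1 ≤ φ z)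
    {z : (Fin 2 → ℝ) × (Fin q → ℝ)} (hz : z ∈ iterSplitClosure S (n + 1)) (hφz : φ z < 1)
    {i : Fin 3} (hi : T.point.coord i z.1 ∈ Ioo 0 1) :
    ∃ v ∈ iterSplitClosure S n, φ v < 1 ∧
      0 < T.point.coord (i + 1) v.1 ∧ T.point.coord (i + 2) v.1 < 0 := by
  generalize ht : T.point.coord i z.1 = t at hi
  obtain ⟨u, hu, v, hv, hu₀, hv₁, rfl⟩ :=
    exists_lineMap_of_mem_iterSplitClosure_succ hS hz (T.isIntegralForm_coord i) ht hi.1 hi.2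
  rw [apply_lineMap, lineMap_apply_ring] at hφz
  have hφv : φ v < 1 := by
    by_contra! h
    nlinarith [hline u hu i hu₀, hi.1, hi.2]
  have hslack : 0 < T.slack i v.1 := by
    linarith [hφ v (iterSplitClosure_antitone hS n.zero_le hv) i]
  rw [slack_eq_of_coord_eq_one T hv₁] at hslack
  have hpos := pos_of_mul_pos_right hslack (sub_pos.2 (hT i)).le
  exact ⟨v, hv, hφv, hpos, by linarith [sum_coord_fin_three T.point v.1 i]⟩

lemma IsCyclic.exists_one_le (hT : T.IsCyclic) (hS : Convex ℝ S)
    (hφ : ∀ z ∈ S, ∀ i, 1 - T.slack i z.1 ≤ φ z) (hm : ∀ z ∈ S, m ≤ φ z) :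
    ∃ n, ∀ z ∈ iterSplitClosure S n, 1 ≤ φ z := by
  obtain ⟨n, hline⟩ := hT.exists_one_le_of_coord_eq_zero hS hφ hm
  have hsign {u v} (hu : u ∈ iterSplitClosure S n) (hφu : φ u < 1)
      (hv : v ∈ iterSplitClosure S n) (hφv : φ v < 1) (i : Fin 3)
      (hui : 0 < T.point.coord i u.1) : 0 < T.point.coord i v.1 :=
    pos_of_forall_ne_zero
      ((convex_iterSplitClosure hS n).inter ((convex_Iio 1).affine_preimage φ))
      ((T.point.coord i).comp AffineMap.fst)
      (fun z hz hzi => (hline z hz.1 i hzi).not_gt hz.2) ⟨hu, hφu⟩ ⟨hv, hφv⟩ hui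
  refine ⟨n + 1, fun z hz => ?_⟩
  by_contra! hφz
  have hzn := iterSplitClosure_antitone hS n.le_succ hz
  have hslack (i : Fin 3) : 0 < T.slack i z.1 := by
    linarith [hφ z (iterSplitClosure_antitone hS (n + 1).zero_le hz) i]
  obtain ⟨i, hi⟩ := hT.exists_coord_mem_Ioo hslack
  obtain ⟨v, hv, hφv, hv₁, hv₂⟩ := hT.exists_lt_one_of_coord_mem_Ioo hS hφ hline hz hφz hi
  have hi' : T.point.coord (i + 1) z.1 ∈ Ioo 0 1 :=
    ⟨hsign hv hφv hzn hφz _ hv₁, hT.coord_add_one_lt_one hslack hi.1.le⟩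
  obtain ⟨v', hv', hφv', hv₁', -⟩ := hT.exists_lt_one_of_coord_mem_Ioo hS hφ hline hz hφz hi'
  rw [add_one_add_one] at hv₁'
  exact (hsign hv' hφv' hv hφv _ hv₁').not_gt hv₂

theorem exists_one_le (T : T3Triangle) (hS : Convex ℝ S)
    (hφ : ∀ z ∈ S, ∀ i, 1 - T.slack i z.1 ≤ φ z) (hm : ∀ z ∈ S, m ≤ φ z) :
    ∃ n, ∀ z ∈ iterSplitClosure S n, 1 ≤ φ z := by
  obtain hT | hT := T.isCyclic_or_isCyclic_reindex_neg
  · exact hT.exists_one_le hS hφ hm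
  · exact hT.exists_one_le hS (fun z hz i => hφ z hz (-i)) hm

end FiniteRank

end T3Triangle

section Rationality

variable {p : ℕ}

lemma exists_eq_ratCast_of_forall_linearMap {t : ℝ}
    (ht : ∀ h : ℝ →ₗ[ℚ] ℚ, h 1 = 0 → h t = 0) : ∃ r : ℚ, t = r := by
  have hmem : t ∈ Submodule.span ℚ {(1 : ℝ)} := by
    by_contra hnot
    obtain ⟨h, hne, hle⟩ := Submodule.exists_le_ker_of_notMem hnot
    exact hne (ht h (hle (Submodule.mem_span_singleton_self 1)))
  obtain ⟨r, rfl⟩ := Submodule.mem_span_singleton.1 hmem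
  exact ⟨r, by rw [Rat.smul_def, mul_one]⟩

lemma exists_affineMap_apply_ratCast (h : ℝ →ₗ[ℚ] ℚ) (g : (Fin p → ℝ) →ᵃ[ℝ] ℝ) :
    ∃ G : (Fin p → ℝ) →ᵃ[ℝ] ℝ,
      ∀ x : Fin p → ℚ, G (fun j => (x j : ℝ)) = h (g fun j => (x j : ℝ)) := by
  refine ⟨(∑ j, (h (g (Pi.single j 1) - g 0) : ℝ) • LinearMap.proj j).toAffineMap +
    const ℝ (Fin p → ℝ) (h (g 0) : ℝ), fun x => ?_⟩
  rw [apply_eq_sum_single g fun j => (x j : ℝ), map_add, map_sum]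
  have hmul (a : ℝ) (r : ℚ) : h (a * r) = h a * r := by
    rw [mul_comm, ← Rat.smul_def, map_smul, smul_eq_mul, mul_comm]
  simp [hmul]

lemma eq_zero_of_zero_mem_openSegment {η : Fin 3 → ℝ}
    (hη : ∀ i, (0 : ℝ) ∈ openSegment ℝ (η (i + 1)) (η (i + 2))) (i : Fin 3) : η i = 0 := by
  have hneg {x y : ℝ} (hxy : (0 : ℝ) ∈ openSegment ℝ x y) (hx : x ≠ 0) : x * y < 0 := by
    obtain ⟨a, b, ha, hb, -, hab⟩ := hxy
    simp only [smul_eq_mul] at hab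
    refine neg_of_mul_neg_right ?_ hb.le
    calc b * (x * y) = -(a * x ^ 2) := by linear_combination x * hab
      _ < 0 := neg_neg_of_pos (mul_pos ha (sq_pos_of_ne_zero hx))
  by_contra hi
  have h₁ := hneg (add_two_add_two i ▸ add_two_add_one i ▸ hη (i + 2)) hi
  have h₂ := hneg (openSegment_symm ℝ (η (i + 2)) _ ▸ add_one_add_one i ▸ add_one_add_two i ▸
    hη (i + 1)) hi
  have h₁₂ := hneg (hη i) (right_ne_zero_of_mul h₁.ne)
  nlinarith [mul_pos_of_neg_of_neg h₁ h₂, sq_nonneg (η i)]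

lemma apply_eq_zero_of_apply_openSegment_eq_zero {V : Type*} [AddCommGroup V] [Module ℝ V]
    (b : AffineBasis (Fin 3) ℝ V) {G : Fin 3 → V →ᵃ[ℝ] ℝ} {η : Fin 3 → ℝ} {f : V} {y : Fin 3 → V}
    (hf : ∀ i, b.coord i f ≠ 0) (hGf : ∀ i, G i f = 0) (hGb : ∀ i j, i ≠ j → G i (b j) = η j)
    (hy : ∀ i, y i ∈ openSegment ℝ (b (i + 1)) (b (i + 2))) (hGy : ∀ i, G i (y i) = 0)
    (i : Fin 3) (x : V) : G i x = 0 := by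
  have hη := eq_zero_of_zero_mem_openSegment (η := η) fun i => by
    rw [← hGb i (i + 1) (add_one_ne_self i).symm, ← hGb i (i + 2) (add_two_ne_self i).symm, ← hGy i]
    obtain ⟨t, ht, hyt⟩ := openSegment_eq_image_lineMap ℝ (b (i + 1)) (b (i + 2)) ▸ hy i
    rw [openSegment_eq_image_lineMap, ← hyt]
    exact ⟨t, ht, (apply_lineMap (G i) _ _ t).symm⟩
  have hGi (x : V) : G i x = b.coord i x * G i (b i) := by
    rw [apply_eq_sum_coord b]
    exact Finset.sum_eq_single i (fun j _ hj => by rw [hGb i j hj.symm, hη, mul_zero]) (by simp)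
  have hGbi : G i (b i) = 0 :=
    (mul_eq_zero.1 ((hGi f).symm.trans (hGf i))).resolve_left (hf i)
  rw [hGi, hGbi, mul_zero]

/- If `h : ℝ → ℚ` is `ℚ`-linear and kills `1`, then `h ∘ g i` agrees at the rational points with an
affine form `G i`; the relations defining the triangle become homogeneous for `G`, so `G = 0`. -/
lemma exists_smul_coord_eq_ratCast (b : AffineBasis (Fin 3) ℝ (Fin 2 → ℝ)) {f : Fin 2 → ℚ}
    {r y : Fin 3 → Fin 2 → ℚ} {a : Fin 3 → ℝ} (hf : ∀ i, b.coord i (fun j => (f j : ℝ)) ≠ 0)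
    (hb : ∀ i, b i = lineMap (fun j => (f j : ℝ)) (fun j => (r i j : ℝ)) (a i))
    (hy : ∀ i, (fun j => (y i j : ℝ)) ∈ openSegment ℝ (b (i + 1)) (b (i + 2))) (i : Fin 3)
    (x : Fin 2 → ℚ) :
    ∃ c : ℚ, (b.coord i fun j => (f j : ℝ))⁻¹ * b.coord i (fun j => (x j : ℝ)) = c := by
  refine exists_eq_ratCast_of_forall_linearMap fun h hone => ?_
  set g := fun i => (b.coord i fun j => (f j : ℝ))⁻¹ • b.coord i with hg
  have hgf (i : Fin 3) : g i (fun j => (f j : ℝ)) = 1 := inv_mul_cancel₀ (hf i)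
  have hgb {i j : Fin 3} (hij : i ≠ j) : g i (b j) = 0 := by
    simp [hg, b.coord_apply_ne hij]
  choose G hG using fun i => exists_affineMap_apply_ratCast h (g i)
  have hGf (i : Fin 3) : G i (fun j => (f j : ℝ)) = 0 := by
    rw [hG, hgf, hone, Rat.cast_zero]
  have hGb (i j : Fin 3) (hij : i ≠ j) : G i (b j) = a j * h (1 - (a j)⁻¹) := by
    have hray := hgb hij
    rw [hb, apply_lineMap, lineMap_apply_ring, hgf] at hray
    have ha : a j ≠ 0 := fun ha => by simp [ha] at hray
    rw [hb, apply_lineMap, lineMap_apply_ring, hGf, hG, mul_zero, zero_add]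
    congr 3
    field_simp
    linarith
  have hGy (i : Fin 3) : G i (fun j => (y i j : ℝ)) = 0 := by
    obtain ⟨t, -, hyt⟩ := openSegment_eq_image_lineMap ℝ (b (i + 1)) (b (i + 2)) ▸ hy i
    rw [hG, ← hyt, apply_lineMap, hgb (add_one_ne_self i).symm, hgb (add_two_ne_self i).symm,
      lineMap_same_apply, map_zero, Rat.cast_zero]
  rw [← Rat.cast_eq_zero (α := ℝ)]
  exact (hG i x).symm.trans (apply_eq_zero_of_apply_openSegment_eq_zero b hf hGf hGb hy hGy i _)

lemma isIntegralForm_of_forall_single {g : (Fin p → ℝ) →ᵃ[ℝ] ℝ} (h₀ : ∃ n : ℤ, g 0 = n)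
    (h₁ : ∀ j, ∃ n : ℤ, g (Pi.single j 1) = n) : IsIntegralForm g := by
  rintro _ ⟨z, rfl⟩
  obtain ⟨n₀, hn₀⟩ := h₀
  choose n hn using h₁
  refine ⟨∑ j, (n j - n₀) * z j + n₀, ?_⟩
  rw [apply_eq_sum_single]
  simp [hn, hn₀]

lemma exists_natCast_mul_eq_intCast {ι : Type*} [Finite ι] (c : ι → ℚ) :
    ∃ N : ℕ, 0 < N ∧ ∀ i, ∃ n : ℤ, (N * c i : ℝ) = n := by
  have := Fintype.ofFinite ι
  refine ⟨∏ i, (c i).den, Finset.prod_pos fun i _ => (c i).den_pos, fun i => ?_⟩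
  obtain ⟨d, hd⟩ := Finset.dvd_prod_of_mem (fun i => (c i).den) (Finset.mem_univ i)
  have hnum : ((c i).den * c i : ℝ) = (c i).num := by
    exact_mod_cast (c i).den_mul_eq_num
  refine ⟨d * (c i).num, ?_⟩
  rw [hd]
  push_cast
  rw [← hnum]
  ring

lemma exists_isIntegralForm_smul_of_ratCast {g : (Fin p → ℝ) →ᵃ[ℝ] ℝ}
    (hg : ∀ z ∈ latticePoints p, ∃ c : ℚ, g z = c) :
    ∃ N : ℕ, 0 < N ∧ IsIntegralForm ((N : ℝ) • g) := by
  obtain ⟨c₀, hc₀⟩ := hg 0 (zero_mem (latticeSubgroup p))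
  choose c hc using fun j => hg _ (single_mem_latticePoints j)
  obtain ⟨N, hN, hint⟩ := exists_natCast_mul_eq_intCast fun o : Option (Fin p) => o.elim c₀ c
  refine ⟨N, hN, isIntegralForm_of_forall_single ?_ fun j => ?_⟩
  · rw [AffineMap.coe_smul, Pi.smul_apply, hc₀]
    exact hint none
  · rw [AffineMap.coe_smul, Pi.smul_apply, hc]
    exact hint (some j)

end Rationality

section Triangles

lemma affineIndependent_of_apply_eq_zero {V : Type*} [AddCommGroup V] [Module ℝ V]
    {g : Fin 3 → V →ᵃ[ℝ] ℝ} {y : Fin 3 → V} (hself : ∀ i, g i (y i) = 0)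
    (hpos : ∀ i j, i ≠ j → 0 < g i (y j)) : AffineIndependent ℝ y := by
  have hbtw {i j l : Fin 3} (hji : j ≠ i) (hjl : j ≠ l) : ¬Wbtw ℝ (y i) (y j) (y l) := by
    rintro ⟨t, ht, hy⟩
    have hmem := (convex_Ioi (0 : ℝ)).lineMap_mem (hpos j i hji) (hpos j l hjl) ht
    refine (mem_Ioi.1 hmem).ne' ?_
    rw [← apply_lineMap, hy, hself]
  have hcol : ¬Collinear ℝ {y 0, y 1, y 2} := fun h =>
    h.wbtw_or_wbtw_or_wbtw.elim (hbtw (by decide) (by decide))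
      (Or.rec (hbtw (by decide) (by decide)) (hbtw (by decide) (by decide)))
  rw [← affineIndependent_iff_not_collinear_set] at hcol
  exact FinVec.etaExpand_eq y ▸ hcol

lemma mem_extremePoints_convexHull_range {ι E : Type*} [Finite ι] [AddCommGroup E] [Module ℝ E]
    (b : AffineBasis ι ℝ E) (i : ι) : b i ∈ (convexHull ℝ (range b)).extremePoints ℝ := by
  have := Fintype.ofFinite ι
  refine ⟨subset_convexHull ℝ _ (mem_range_self i), fun u hu v hv huv => ?_⟩
  rw [b.convexHull_eq_nonneg_coord] at hu hv
  obtain ⟨t, ⟨ht₀, ht₁⟩, ht⟩ := openSegment_eq_image_lineMap ℝ u v ▸ huv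
  have hne (j : ι) (hj : j ≠ i) : b.coord j u = 0 := by
    have hcomb := b.coord_apply_ne hj
    rw [← ht, apply_lineMap, lineMap_apply_ring] at hcomb
    nlinarith [hu j, mul_nonneg ht₀.le (hv j), mul_nonneg (sub_pos.2 ht₁).le (hu j)]
  have hself : b.coord i u = 1 := by
    rw [← b.sum_coord_apply_eq_one u]
    exact (Finset.sum_eq_single i (fun j _ => hne j) (by simp)).symm
  refine b.ext_elem fun j => ?_
  obtain rfl | hj := eq_or_ne j i
  · rw [hself, b.coord_apply_eq]
  · rw [hne j hj, b.coord_apply_ne hj]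

variable (b : AffineBasis (Fin 3) ℝ (Fin 2 → ℝ)) {f : Fin 2 → ℝ}

lemma coord_of_mem_openSegment {i : Fin 3} {y : Fin 2 → ℝ}
    (hy : y ∈ openSegment ℝ (b (i + 1)) (b (i + 2))) :
    b.coord i y = 0 ∧ 0 < b.coord (i + 1) y ∧ 0 < b.coord (i + 2) y := by
  obtain ⟨t, ⟨ht₀, ht₁⟩, rfl⟩ := openSegment_eq_image_lineMap ℝ (b (i + 1)) (b (i + 2)) ▸ hy
  simp only [apply_lineMap, lineMap_apply_ring, b.coord_apply_eq,
    b.coord_apply_ne (add_one_ne_self i).symm, b.coord_apply_ne (add_two_ne_self i).symm,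
    b.coord_apply_ne (add_two_ne_add_one i), b.coord_apply_ne (add_two_ne_add_one i).symm]
  exact ⟨by ring, by linarith, by linarith⟩

lemma coord_pos_of_mem_openSegment {y : Fin 3 → Fin 2 → ℝ}
    (hy : ∀ i, y i ∈ openSegment ℝ (b (i + 1)) (b (i + 2))) (i j : Fin 3) (hij : i ≠ j) :
    0 < b.coord i (y j) := by
  refine (forall_fin_three (P := fun l => l ≠ j → 0 < b.coord l (y j)) j).2 ?_ i hij
  obtain ⟨-, h₁, h₂⟩ := coord_of_mem_openSegment b (hy j)
  exact ⟨fun h => absurd rfl h, fun _ => h₁, fun _ => h₂⟩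

lemma coord_ne_zero {L : Set (Fin 2 → ℝ)} (hf : f ∉ L)
    (hb : ∀ i, Disjoint (openSegment ℝ f (b i)) L) {i : Fin 3} {y : Fin 2 → ℝ} (hyL : y ∈ L)
    (hy : y ∈ openSegment ℝ (b (i + 1)) (b (i + 2))) : b.coord i f ≠ 0 := by
  intro hi
  have hsum := sum_coord_fin_three b f i
  have hline : f ∈ range (lineMap (b (i + 1)) (b (i + 2)) : ℝ → Fin 2 → ℝ) := by
    refine ⟨b.coord (i + 2) f, b.ext_elem ((forall_fin_three i).2 ?_)⟩
    simp only [apply_lineMap, lineMap_apply_ring, b.coord_apply_eq,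
      b.coord_apply_ne (add_one_ne_self i).symm, b.coord_apply_ne (add_two_ne_self i).symm,
      b.coord_apply_ne (add_two_ne_add_one i), b.coord_apply_ne (add_two_ne_add_one i).symm]
    exact ⟨by linarith, by linarith, by linarith⟩
  obtain rfl | hseg | hseg := openSegment_subset_union _ _ hline hy
  · exact hf hyL
  · exact disjoint_left.1 (hb _) (openSegment_symm ℝ f _ ▸ hseg) hyL
  · exact disjoint_left.1 (hb _) hseg hyL

end Triangles

lemma IsTypeT3.exists_affineBasis {T : Set (Fin 2 → ℝ)} (hT : IsTypeT3 T) :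
    ∃ (b : AffineBasis (Fin 3) ℝ (Fin 2 → ℝ)) (y : Fin 3 → Fin 2 → ℝ),
      T = convexHull ℝ (range b) ∧ (∀ i, y i ∈ latticePoints 2) ∧
      (∀ i, y i ∈ openSegment ℝ (b (i + 1)) (b (i + 2))) ∧ T ∩ latticePoints 2 ⊆ range y := by
  obtain ⟨w, hw, rfl, hfree, -, hcard, hside⟩ := hT
  obtain ⟨b, rfl⟩ : ∃ b : AffineBasis (Fin 3) ℝ (Fin 2 → ℝ), w = b :=
    ⟨⟨w, hw, hw.affineSpan_eq_top_iff_card_eq_finrank_add_one.2 (by simp)⟩, rfl⟩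
  choose y hy using fun i : Fin 3 => (hside (i + 1) (i + 2) (add_two_ne_add_one i).symm).exists
  refine ⟨b, y, rfl, fun i => (hy i).2, fun i => (hy i).1, ?_⟩
  have hclosed : IsClosed (convexHull ℝ (range b)) :=
    ((finite_range b).isCompact_convexHull ℝ).isClosed
  have hsub : convexHull ℝ (range b) ∩ latticePoints 2 ⊆
      frontier (convexHull ℝ (range b)) ∩ latticePoints 2 := by
    rw [hclosed.frontier_eq]
    exact fun x hx => ⟨⟨hx.1, fun hxi => hfree.subset ⟨hxi, hx.2⟩⟩, hx.2⟩
  have hyinj : Function.Injective y :=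
    (affineIndependent_of_apply_eq_zero (fun i => (coord_of_mem_openSegment b (hy i).1).1)
      (coord_pos_of_mem_openSegment b fun i => (hy i).1)).injective
  have hyT : range y ⊆ frontier (convexHull ℝ (range b)) ∩ latticePoints 2 := by
    refine fun _ ⟨i, hi⟩ => hsub (hi ▸ ⟨?_, (hy i).2⟩)
    exact (convex_convexHull ℝ _).openSegment_subset (subset_convexHull ℝ _ (mem_range_self _))
      (subset_convexHull ℝ _ (mem_range_self _)) (hy i).1
  have hfin := finite_of_ncard_ne_zero (hcard.trans_ne three_ne_zero)
  refine hsub.trans (eq_of_subset_of_ncard_le hyT ?_ hfin).ge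
  rw [hcard, ← image_univ, ncard_image_of_injective _ hyinj, ncard_univ, Nat.card_fin]

section Application

lemma coord_pos_of_convexHull_eq {κ : Type*} {f : Fin 2 → ℝ} {v : κ → Fin 2 → ℝ}
    {L : Set (Fin 2 → ℝ)} {b : AffineBasis (Fin 3) ℝ (Fin 2 → ℝ)} {y : Fin 3 → Fin 2 → ℝ}
    (hhull : convexHull ℝ (insert f (range v)) = convexHull ℝ (range b)) (hf : f ∉ L)
    (hv : ∀ j, Disjoint (openSegment ℝ f (v j)) L) (hyL : ∀ i, y i ∈ L)
    (hy : ∀ i, y i ∈ openSegment ℝ (b (i + 1)) (b (i + 2))) (i : Fin 3) : 0 < b.coord i f := by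
  have hfT : f ∈ convexHull ℝ (range b) := hhull ▸ subset_convexHull ℝ _ (mem_insert f _)
  rw [b.convexHull_eq_nonneg_coord] at hfT
  refine (hfT i).lt_of_ne' (coord_ne_zero b hf (fun j => ?_) (hyL i) (hy i))
  obtain hbf | ⟨l, hl⟩ :=
    extremePoints_convexHull_subset (hhull ▸ mem_extremePoints_convexHull_range b j)
  · rw [hbf, openSegment_same]
    exact disjoint_singleton_left.2 hf
  · exact hl ▸ hv l

lemma exists_eq_of_convexHull_eq {κ : Type*} {f : Fin 2 → ℝ} {v : κ → Fin 2 → ℝ}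
    {b : AffineBasis (Fin 3) ℝ (Fin 2 → ℝ)}
    (hhull : convexHull ℝ (insert f (range v)) = convexHull ℝ (range b))
    (hf : ∀ i, 0 < b.coord i f) (i : Fin 3) : ∃ j, v j = b i := by
  refine (extremePoints_convexHull_subset
    (hhull ▸ mem_extremePoints_convexHull_range b i)).resolve_left fun hbf => ?_
  have hpos := hf (i + 1)
  rw [← hbf, b.coord_apply_ne (add_one_ne_self i)] at hpos
  exact hpos.false

lemma exists_isIntegralForm_smul_coord {f : Fin 2 → ℚ} {b : AffineBasis (Fin 3) ℝ (Fin 2 → ℝ)}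
    {y : Fin 3 → Fin 2 → ℝ} (hf : ∀ i, b.coord i (toReal f) ≠ 0)
    (hb : ∀ i, ∃ (r : Fin 2 → ℚ) (a : ℝ), b i = lineMap (toReal f) (toReal r) a)
    (hyL : ∀ i, y i ∈ latticePoints 2) (hy : ∀ i, y i ∈ openSegment ℝ (b (i + 1)) (b (i + 2)))
    (i : Fin 3) :
    ∃ N : ℕ, 0 < N ∧ IsIntegralForm ((N : ℝ) • (b.coord i (toReal f))⁻¹ • b.coord i) := by
  choose r a hra using hb
  choose z hz using hyL
  have hcast (w : Fin 2 → ℤ) : (fun j => ((w j : ℚ) : ℝ)) = fun j => (w j : ℝ) :=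
    funext fun _ => Rat.cast_intCast _
  refine exists_isIntegralForm_smul_of_ratCast ?_
  rintro _ ⟨w, rfl⟩
  beta_reduce
  rw [← hcast w]
  exact exists_smul_coord_eq_ratCast b hf hra (fun i => (hcast (z i)).trans (hz i) ▸ hy i) i _

lemma IsTypeT3.exists_t3Triangle {κ : Type*} {f : Fin 2 → ℚ} {v : κ → Fin 2 → ℝ}
    (hT : IsTypeT3 (convexHull ℝ (insert (toReal f) (range v))))
    (hf : toReal f ∉ latticePoints 2)
    (hv : ∀ j, Disjoint (openSegment ℝ (toReal f) (v j)) (latticePoints 2))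
    (hrat : ∀ j, ∃ (r : Fin 2 → ℚ) (a : ℝ), v j = lineMap (toReal f) (toReal r) a) :
    ∃ T : T3Triangle, ∀ i, T.slack i (toReal f) = 1 ∧ ∀ j, 0 ≤ T.slack i (v j) := by
  obtain ⟨b, y, hhull, hyL, hy, hrange⟩ := hT.exists_affineBasis
  rw [hhull] at hrange
  have hpos := coord_pos_of_convexHull_eq hhull hf hv hyL hy
  have hset : {x | ∀ i, 0 ≤ ((b.coord i (toReal f))⁻¹ • b.coord i) x} =
      convexHull ℝ (range b) := by
    simp only [AffineMap.coe_smul, Pi.smul_apply, smul_eq_mul, inv_pos.2 (hpos _),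
      mul_nonneg_iff_of_pos_left, b.convexHull_eq_nonneg_coord]
  have hself (i : Fin 3) : b.coord i (y i) = 0 := (coord_of_mem_openSegment b (hy i)).1
  have hypos := coord_pos_of_mem_openSegment b hy
  have hindep : AffineIndependent ℝ y := affineIndependent_of_apply_eq_zero hself hypos
  have hb (i : Fin 3) : ∃ (r : Fin 2 → ℚ) (a : ℝ), b i = lineMap (toReal f) (toReal r) a := by
    obtain ⟨j, hj⟩ := exists_eq_of_convexHull_eq hhull hpos i
    exact hj ▸ hrat j
  let T : T3Triangle :=
    { slack := fun i => (b.coord i (toReal f))⁻¹ • b.coord i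
      point := ⟨y, hindep, hindep.affineSpan_eq_top_iff_card_eq_finrank_add_one.2 (by simp)⟩
      point_mem := hyL
      slack_point_self := fun i => mul_eq_zero_of_right _ (hself i)
      slack_point_pos := fun i j hij => mul_pos (inv_pos.2 (hpos i)) (hypos i j hij)
      mem_range_point := fun x hx hx0 => hrange ⟨hset.subset hx0, hx⟩
      exists_isIntegralForm_smul := fun i =>
        exists_isIntegralForm_smul_coord (fun i => (hpos i).ne') hb hyL hy i
      isCompact := hset ▸ (finite_range b).isCompact_convexHull ℝ }
  refine ⟨T, fun i => ⟨inv_mul_cancel₀ (hpos i).ne', fun j => hset.superset ?_ i⟩⟩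
  exact hhull ▸ subset_convexHull ℝ _ (mem_insert_of_mem _ (mem_range_self j))

variable {k : ℕ} {R : Matrix (Fin 2) (Fin k) ℚ} {f : Fin 2 → ℚ} {α : Fin k → ℝ}

lemma toReal_add_smul_col (f : Fin 2 → ℚ) (R : Matrix (Fin 2) (Fin k) ℚ) (i : Fin k) (t : ℝ) :
    toReal f + t • col R i = lineMap (toReal f) (toReal fun l => f l + R l i) t := by
  ext l
  simp [toReal, col, lineMap_apply, add_comm]

lemma convex_relaxation (R : Matrix (Fin 2) (Fin k) ℚ) (f : Fin 2 → ℚ) :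
    Convex ℝ (relaxation R f) := by
  rintro u ⟨hu, hu0⟩ v ⟨hv, hv0⟩ a b ha hb hab
  refine ⟨?_, fun i => add_nonneg (mul_nonneg ha (hu0 i)) (mul_nonneg hb (hv0 i))⟩
  simp only [Prod.fst_add, Prod.smul_fst, ← hu, ← hv, Prod.snd_add, Prod.smul_snd, Pi.add_apply,
    Pi.smul_apply, smul_eq_mul, add_smul, mul_smul, Finset.sum_add_distrib, ← Finset.smul_sum]
  nth_rw 1 [← one_smul ℝ (toReal f), ← hab]
  module

lemma add_smul_col_mem_relaxation (i : Fin k) {t : ℝ} (ht : 0 ≤ t) :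
    (toReal f + t • col R i, Pi.single i t) ∈ relaxation R f := by
  refine ⟨?_, fun j => ?_⟩
  · rw [Finset.sum_eq_single i (fun j _ hj => by simp [hj]) (by simp)]
    exact congrArg (toReal f + · • col R i) (Pi.single_eq_same (M := fun _ => ℝ) i t)
  · exact (Pi.single_nonneg.2 ht : 0 ≤ Pi.single (M := fun _ => ℝ) i t) j

lemma add_smul_col_mem_inducedSet {i : Fin k} (hi : α i = 0) {t : ℝ} (ht : 0 ≤ t) :
    toReal f + t • col R i ∈ inducedSet R f α := by
  obtain ⟨hsum, hnonneg⟩ := add_smul_col_mem_relaxation (R := R) (f := f) i ht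
  refine ⟨_, subset_convexHull ℝ _ (mem_insert _ _), _, ⟨_, hnonneg, fun j hj => ?_, rfl⟩, hsum⟩
  exact Pi.single_eq_of_ne (M := fun _ => ℝ) (fun hji : j = i => hj (hji ▸ hi)) t

lemma coeff_pos_of_isBounded (hR : ∀ i, col R i ≠ 0) (hα : ∀ i, 0 ≤ α i)
    (hb : Bornology.IsBounded (inducedSet R f α)) (i : Fin k) : 0 < α i := by
  refine (hα i).lt_of_ne' fun hi => ?_
  obtain ⟨C, hC⟩ := hb.exists_norm_le
  have hlim : Filter.Tendsto (fun t : ℝ => ‖t • col R i‖) Filter.atTop Filter.atTop := by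
    simp only [norm_smul]
    exact tendsto_norm_atTop_atTop.atTop_mul_const (norm_pos_iff.2 (hR i))
  obtain ⟨t, ht, ht0⟩ := ((hlim.eventually_gt_atTop (C + ‖toReal f‖)).and
    (Filter.eventually_ge_atTop 0)).exists
  have hle := hC _ (add_smul_col_mem_inducedSet hi ht0)
  linarith [norm_le_add_norm_add (t • col R i) (toReal f), add_comm (toReal f) (t • col R i) ▸ hle]

lemma inducedSet_eq_convexHull (hα : ∀ i, 0 < α i) :
    inducedSet R f α =
      convexHull ℝ (insert (toReal f) (range fun i => toReal f + (α i)⁻¹ • col R i)) := by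
  have hcone : {y | ∃ c : Fin k → ℝ, (∀ i, 0 ≤ c i) ∧ (∀ i, α i ≠ 0 → c i = 0) ∧
      y = ∑ i, c i • col R i} = {0} := by
    refine Subset.antisymm ?_ (singleton_subset_iff.2 ⟨0, by simp⟩)
    rintro _ ⟨c, -, hc, rfl⟩
    exact Finset.sum_eq_zero fun i _ => by rw [hc i (hα i).ne', zero_smul]
  rw [inducedSet, hcone, add_singleton]
  simp only [hα, true_and, range, eq_comm, add_zero, image_id']

/- The point `f + t (α i)⁻¹ rⁱ` comes from an element of `P(R,f)` at which `∑ αⱼ sⱼ = t`. -/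
lemma disjoint_openSegment_latticePoints
    (hv : IsValidIneq 0 (-α) (-1) (mixedIntegerSet R f)) {i : Fin k} (hi : 0 < α i) :
    Disjoint (openSegment ℝ (toReal f) (toReal f + (α i)⁻¹ • col R i)) (latticePoints 2) := by
  refine disjoint_left.2 fun y hy hyL => ?_
  rw [openSegment_eq_image'] at hy
  obtain ⟨t, ⟨ht₀, ht₁⟩, rfl⟩ := hy
  beta_reduce at hyL
  rw [add_sub_cancel_left, smul_smul] at hyL
  have hle := hv _ ⟨add_smul_col_mem_relaxation i (mul_nonneg ht₀.le (inv_nonneg.2 hi.le)), hyL⟩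
  rw [Finset.sum_eq_single (f := fun j => (-α) j * _) i (fun j _ hj => by simp [hj])
    (by simp)] at hle
  simp only [Pi.zero_apply, zero_mul, Finset.sum_const_zero, zero_add, Pi.neg_apply,
    Pi.single_eq_same, neg_mul, mul_left_comm (α i), mul_inv_cancel₀ hi.ne', mul_one] at hle
  linarith

lemma one_sub_le_sum_of_mem_relaxation (hα : ∀ i, 0 < α i) {g : (Fin 2 → ℝ) →ᵃ[ℝ] ℝ}
    (hf : g (toReal f) = 1) (hg : ∀ i, 0 ≤ g (toReal f + (α i)⁻¹ • col R i))
    {z : (Fin 2 → ℝ) × (Fin k → ℝ)} (hz : z ∈ relaxation R f) :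
    1 - g z.1 ≤ ∑ i, α i * z.2 i := by
  have happly (u : Fin 2 → ℝ) : g (toReal f + u) = 1 + g.linear u := by
    rw [add_comm, ← vadd_eq_add, AffineMap.map_vadd, hf, vadd_eq_add, add_comm]
  have hlin (i : Fin k) : -(α i * z.2 i) ≤ z.2 i * g.linear (col R i) := by
    have hi := mul_nonneg (hα i).le (hg i)
    rw [happly, map_smul, smul_eq_mul, mul_add, mul_inv_cancel_left₀ (hα i).ne'] at hi
    linarith [mul_nonneg (hz.2 i) hi]
  rw [← hz.1, happly, map_sum]
  simp only [map_smul, smul_eq_mul]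
  linarith [Finset.sum_le_sum fun i (_ : i ∈ Finset.univ) => hlin i,
    Finset.sum_neg_distrib (s := Finset.univ) fun i => α i * z.2 i]

lemma splitRank_lt_top {p q : ℕ} {S : Set ((Fin p → ℝ) × (Fin q → ℝ))} {a : Fin p → ℝ}
    {b : Fin q → ℝ} {c : ℝ} {n : ℕ} (h : IsValidIneq a b c (iterSplitClosure S n)) :
    splitRank S a b c < ⊤ :=
  lt_of_le_of_lt (sInf_le ⟨n, rfl, h⟩) (ENat.natCast_lt_top n)

lemma IsTypeT3.isBounded {T : Set (Fin 2 → ℝ)} (hT : IsTypeT3 T) : Bornology.IsBounded T := by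
  obtain ⟨w, -, rfl, -⟩ := hT
  exact ((finite_range w).isCompact_convexHull ℝ).isBounded

end Application

end SplitRank

theorem mainTheorem4 (k : ℕ) (R : Matrix (Fin 2) (Fin k) ℚ) (f : Fin 2 → ℚ)
    (hf : SplitRank.toReal f ∉ SplitRank.latticePoints 2)
    (hR : ∀ i, SplitRank.col R i ≠ 0)
    (hP : (SplitRank.mixedIntegerSet R f).Nonempty)
    (α : Fin k → ℝ) (hα : ∀ i, 0 ≤ α i)
    (hvalid : SplitRank.IsValidIneq 0 (-α) (-1)
      (convexHull ℝ (SplitRank.mixedIntegerSet R f)))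
    (hT3 : SplitRank.IsTypeT3 (SplitRank.inducedSet R f α)) :
    SplitRank.splitRank (SplitRank.relaxation R f) 0 (-α) (-1) < ⊤ := by
  open SplitRank in
  have hαpos : ∀ i, 0 < α i := coeff_pos_of_isBounded hR hα hT3.isBounded
  rw [inducedSet_eq_convexHull hαpos] at hT3
  obtain ⟨T, hT⟩ := hT3.exists_t3Triangle hf
    (fun j => disjoint_openSegment_latticePoints
      (fun z hz => hvalid z (subset_convexHull ℝ _ hz)) (hαpos j))
    (fun j => ⟨fun l => f l + R l j, (α j)⁻¹, toReal_add_smul_col f R j _⟩)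
  let φ : (Fin 2 → ℝ) × (Fin k → ℝ) →ₗ[ℝ] ℝ := dotProductBilin ℝ ℝ α ∘ₗ LinearMap.snd ℝ _ _
  obtain ⟨n, hn⟩ := T.exists_one_le (φ := φ.toAffineMap) (m := 0) (convex_relaxation R f)
    (fun z hz i => one_sub_le_sum_of_mem_relaxation hαpos (hT i).1 (hT i).2 hz)
    (fun z hz => dotProduct_nonneg_of_nonneg (v := α) (w := z.2) hα hz.2)
  exact splitRank_lt_top fun z hz => by simpa [φ, dotProduct] using hn z hz
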